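/- **Setting.** Let $X$ be a finite group, $G\le X$ a subgroup and $M\subset X$ a set containing the identity $e$ such that every $x\in X$ is uniquely $x=us$ with $u\in G$, $s\in M$. Write $x=|x|^{-1}\langle x\rangle$ with $|x|\in G$, $\langle x\rangle\in M$, and $st=\tau(s,t)\,(s\cdot t)$ for $s,t\in M$, with $\tau(s,t)\in G$ and $s\cdot t\in M$. For $y,z,x\in X$ put $$y\circ z=|z|^{-1}y\langle z\rangle,\qquad y\,\tilde\triangleleft\,x=x^{-1}yx,\qquad z\,\tilde\triangleright\,x=|z|\,x\,|z\,\tilde\triangleleft\,x|^{-1}.$$ Assume that for all $y,x\in X$ there is a unique element $a=:\|\delta_y\otimes x\|$ of $X$ with $y\circ a=x^{-1}yx$ (for instance, this holds if every left translation of $(M,\cdot)$ is bijective). Let $k$ be a field. The braided category $\mathcal D$ has as objects the $k$-vector spaces $V$ with an $X$-grading $\|\cdot\|$ and a right $X$-action $\hat\triangleleft$ such that $\|\xi\hat\triangleleft x\|=\|\xi\|\tilde\triangleleft x$ for homogeneous $\xi$; its morphisms are the linear maps preserving the grading and commuting with the $X$-action. On homogeneous elements, $$\|\xi\otimes\eta\|=\|\xi\|\circ\|\eta\|,\qquad(\xi\otimes\eta)\hat\triangleleft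 x=\xi\hat\triangleleft(\|\eta\|\tilde\triangleright x)\otimes\eta\hat\triangleleft x,$$ $$\Phi((\xi\otimes\eta)\otimes\zeta)=\xi\hat\triangleleft\tau(\langle\eta\rangle,\langle\zeta\rangle)\otimes(\eta\otimes\zeta),\qquad \Psi(\xi\otimes\eta)=\eta\hat\triangleleft\langle\langle\xi\rangle|\eta|\rangle^{-1}\otimes\xi\hat\triangleleft|\eta|,$$ where $\langle\xi\rangle=\langle\|\xi\|\rangle$, $|\xi|=|\|\xi\||$, $\Phi$ is the associator and $\Psi$ the braiding. The braided Hopf algebra $D$ in $\mathcal D$ has basis $\delta_y\otimes x$ ($y,x\in X$), with degrees $\|\delta_y\otimes x\|$. With $a=\|\delta_y\otimes x\|$ and $b=\|\delta_w\otimes z\|$ its action, product, unit and counit are $$(\delta_y\otimes x)\hat\triangleleft z=\delta_{y\tilde\triangleleft(a\tilde\triangleright z)}\otimes(a\tilde\triangleright z)^{-1}xz,\qquad(\delta_y\otimes x)(\delta_w\otimes z)=\delta_{w,\,y\tilde\triangleleft x}\;\delta_{y\tilde\triangleleft t}\otimes t^{-1}xz,\quad t=\tau(\langle a\rangle,\langle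 b\rangle),$$ $1=\sum_y\delta_y\otimes e$ and $\epsilon(\delta_y\otimes x)=\delta_{y,e}$. Every object of $\mathcal D$ carries the canonical action $\xi\,(\delta_y\otimes x)=\delta_{y,\|\xi\|}\,\xi\hat\triangleleft x$ of $D$. The coproduct $\Delta$ is the one through which (using $\Psi$, and inserting associators) $D$ acts canonically on tensor products of objects of $\mathcal D$. The antipode is $S(\delta_y\otimes x)=\delta_{\langle a\rangle x^{-1}y^{-1}x\langle a\rangle^{-1}}\otimes\langle a\rangle x^{-1}|a|$. A *right representation* of $D$ is an object $V$ of $\mathcal D$ with a morphism $\rho:V\otimes D\to V$ of $\mathcal D$ such that $\rho(\rho\otimes\mathrm{id})=\rho(\mathrm{id}\otimes\mu)\Phi$, with $\mu$ the product of $D$, and $\rho(\xi\otimes1)=\xi$. A *subrepresentation* is a subobject $W\subset V$ in $\mathcal D$ (a graded, $X$-stable subspace) with $\rho(W\otimes D)\subset W$. A *right integral* is a non-zero $\Lambda\in D$ with $\Lambda h=\epsilon(h)\Lambda$ for all $h\in D$. For a linear map $t:V\to U$ between right representations let $t_0:V\to U$ be the composite $$V\xrightarrow{\ \cdot\otimes\Lambda\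 }V\otimes D\xrightarrow{\mathrm{id}\otimes(S\otimes\mathrm{id})\Delta}V\otimes(D\otimes D)\xrightarrow{\Phi^{-1}}(V\otimes D)\otimes D\xrightarrow{\rho_V\otimes\mathrm{id}}V\otimes D\xrightarrow{t\otimes\mathrm{id}}U\otimes D\xrightarrow{\rho_U}U .$$ **Proposition.** Let $\Lambda\in D$ be a right integral with $\epsilon(\Lambda)=1$, let $V$ be a right representation of $D$ and $W\subset V$ a subrepresentation. Then: 1. There is a subrepresentation $W_0\subset V$ with $V=W\oplus W_0$. 2. There is a projection $p:V\to V$ with image $W$ which is a morphism of $\mathcal D$. 3. Let $p:V\to V$ be any linear projection with image $W$. Suppose that the action of $D$ on $V$ is the canonical one, or that $p$ is a morphism of $\mathcal D$. Then $p_0$ is a projection with image $W$, it is a morphism of $\mathcal D$ and commutes with the action of $D$, its kernel $W_0=\ker p_0$ is a subrepresentation, and $V=W\oplus W_0$. -/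

import Mathlib

open scoped TensorProduct

set_option linter.unusedSectionVars false

/-! ### Coset representatives, the set `Y` and the operations `∘`, `◁~`, `▷~` -/

section Factorisation

variable {X : Type*} [Group X] {G : Subgroup X} {M : Set X}

/-- The factor `s = ⟨x⟩ ∈ M` in the unique factorisation `x = u s`, `u ∈ G`, `s ∈ M`. -/
noncomputable def cosetRep (h : Subgroup.IsComplement (G : Set X) M) (x : X) : X :=
  ((h.equiv x).2 : X)

/-- `|x| = u⁻¹ ∈ G` for the unique factorisation `x = u s`, so that `x = |x|⁻¹ ⟨x⟩`. -/
noncomputable def cosetAbs (h : Subgroup.IsComplement (G : Set X) M) (x : X) : X :=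
  (((h.equiv x).1 : X))⁻¹

/-- The binary operation `y ∘ z = |z|⁻¹ y ⟨z⟩`, that is `us ∘ vt = v u s t`. -/
noncomputable def cosetCirc (h : Subgroup.IsComplement (G : Set X) M) (y z : X) : X :=
  (cosetAbs h z)⁻¹ * y * cosetRep h z

end Factorisation

/-- A subgroup `G` of `X` with a set `M` of representatives containing the identity, every element
of `X` being uniquely `u s` with `u ∈ G`, `s ∈ M`.  The last field says that the equation
`y ∘ ‖δ_y ⊗ x‖ = x⁻¹ y x`, which defines the degree of the element `δ_y ⊗ x` of `D`,
has exactly one solution. -/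
structure CosetData (X : Type*) [Group X] where
  G : Subgroup X
  M : Set X
  compl : Subgroup.IsComplement (G : Set X) M
  one_mem : (1 : X) ∈ M
  existsUnique_deg : ∀ y x : X, ∃! a : X, cosetCirc compl y a = x⁻¹ * y * x

namespace CosetData

variable {X : Type*} [Group X] (C : CosetData X)

/-- `⟨y⟩ ∈ M`, where `y = |y|⁻¹ ⟨y⟩`. -/
noncomputable def rep (y : X) : X := cosetRep C.compl y

/-- `|y| ∈ G`, where `y = |y|⁻¹ ⟨y⟩`. -/
noncomputable def abs (y : X) : X := cosetAbs C.compl y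

/-- `y ∘ z`. -/
noncomputable def circ (y z : X) : X := cosetCirc C.compl y z

/-- `y ◁~ x = x⁻¹ y x`. -/
def conj (_ : CosetData X) (y x : X) : X := x⁻¹ * y * x

/-- `z ▷~ x = v⁻¹ x v'` where `z = v t` and `z ◁~ x = v' t'` (`v, v' ∈ G`, `t, t' ∈ M`). -/
noncomputable def lact (z x : X) : X := C.abs z * x * (C.abs (C.conj z x))⁻¹

/-- `τ~(a, b) = τ(⟨a⟩, ⟨b⟩)`, where `s t = τ(s, t) (s · t)` with `τ(s, t) ∈ G`, `s · t ∈ M`. -/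
noncomputable def tau (a b : X) : X := (C.abs (C.rep a * C.rep b))⁻¹

/-- The degree `‖δ_y ⊗ x‖` of the basis element `d = δ_y ⊗ x` of `D`. -/
noncomputable def deg (d : X × X) : X := (C.existsUnique_deg d.1 d.2).choose

theorem abs_inv_mul_rep (y : X) : (C.abs y)⁻¹ * C.rep y = y := by
  have h := C.compl.equiv_fst_mul_equiv_snd y
  simpa [abs, rep, cosetAbs, cosetRep] using h

theorem circ_eq (y z : X) : C.circ y z = (C.abs z)⁻¹ * y * C.rep z := rfl

theorem rep_eq (y : X) : C.rep y = C.abs y * y := by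
  have := C.abs_inv_mul_rep y
  rwa [inv_mul_eq_iff_eq_mul] at this

theorem circ_deg (d : X × X) : C.circ d.1 (C.deg d) = C.conj d.1 d.2 :=
  (C.existsUnique_deg d.1 d.2).choose_spec.1

theorem deg_eq {d : X × X} {a : X} (h : C.circ d.1 a = C.conj d.1 d.2) : C.deg d = a :=
  ((C.existsUnique_deg d.1 d.2).choose_spec.2 a h).symm

theorem conj_one (y : X) : C.conj y 1 = y := by simp [conj]

theorem conj_mul (y x z : X) : C.conj y (x * z) = C.conj (C.conj y x) z := by
  simp [conj, mul_assoc]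

theorem lact_one (z : X) : C.lact z 1 = 1 := by simp [lact, conj_one]

theorem lact_mul (z x y : X) : C.lact z (x * y) = C.lact z x * C.lact (C.conj z x) y := by
  simp only [lact, conj_mul]; group

theorem conj_circ (z w x : X) :
    C.conj (C.circ z w) x = C.circ (C.conj z (C.lact w x)) (C.conj w x) := by
  simp only [circ_eq, rep_eq, lact]
  generalize C.abs (C.conj w x) = q
  simp only [conj]; group

theorem rep_abs_mul {u s : X} (hu : u ∈ C.G) (hs : s ∈ C.M) :
    C.rep (u * s) = s ∧ C.abs (u * s) = u⁻¹ := by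
  have h : C.compl.equiv (u * s) = (⟨u, hu⟩, ⟨s, hs⟩) := by
    rw [← Equiv.eq_symm_apply]; rfl
  simp [rep, abs, cosetRep, cosetAbs, h]

theorem abs_mem (y : X) : C.abs y ∈ C.G := by
  simp [abs, cosetAbs]

theorem rep_mem (y : X) : C.rep y ∈ C.M := by
  simp [rep, cosetRep]

theorem rep_mul_left {u : X} (hu : u ∈ C.G) (x : X) : C.rep (u * x) = C.rep x := by
  conv_lhs => rw [← C.abs_inv_mul_rep x, ← mul_assoc]
  exact (C.rep_abs_mul (C.G.mul_mem hu (C.G.inv_mem (C.abs_mem x))) (C.rep_mem x)).1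

theorem abs_mul_left {u : X} (hu : u ∈ C.G) (x : X) : C.abs (u * x) = C.abs x * u⁻¹ := by
  conv_lhs => rw [← C.abs_inv_mul_rep x, ← mul_assoc]
  rw [(C.rep_abs_mul (C.G.mul_mem hu (C.G.inv_mem (C.abs_mem x))) (C.rep_mem x)).2]
  group

theorem rep_rep_mul (y : X) {u : X} (hu : u ∈ C.G) : C.rep (C.rep y * u) = C.rep (C.conj y u) := by
  rw [C.rep_eq y, mul_assoc, C.rep_mul_left (C.abs_mem y), conj, mul_assoc,
    C.rep_mul_left (C.G.inv_mem hu)]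

theorem tau_eq (a b : X) : C.tau a b = C.abs a * C.abs b * (C.abs (C.circ a b))⁻¹ := by
  have h : C.rep a * C.rep b = (C.abs a * C.abs b) * C.circ a b := by
    rw [circ_eq, rep_eq]; group
  rw [tau, h, C.abs_mul_left (C.G.mul_mem (C.abs_mem a) (C.abs_mem b))]
  group

end CosetData

/-! ### The category `𝒟` -/

/-- An object of `𝒟` with underlying vector space `V`: a grading `V = ⨁ V_y` by the set `Y = X`
(given by the projections `proj y` onto the homogeneous components) and a right action `ξ ↦ ξ ◁^ x`
of the group `X` (written `act x`) such that `‖ξ ◁^ x‖ = ‖ξ‖ ◁~ x`. -/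
structure DObj {X : Type*} [Group X] [Fintype X] [DecidableEq X] (C : CosetData X)
    (k : Type*) [Field k] (V : Type*) [AddCommGroup V] [Module k V] where
  proj : X → V →ₗ[k] V
  proj_proj : ∀ y z v, proj y (proj z v) = if y = z then proj z v else 0
  sum_proj : ∀ v, ∑ y, proj y v = v
  act : X → V →ₗ[k] V
  act_one : ∀ v, act 1 v = v
  act_mul : ∀ x y v, act (x * y) v = act y (act x v)
  act_proj : ∀ x y v, act x (proj y v) = proj (C.conj y x) (act x v)

namespace DObj

variable {X : Type*} [Group X] [Fintype X] [DecidableEq X] {C : CosetData X}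
  {k : Type*} [Field k] {V : Type*} [AddCommGroup V] [Module k V]
  {W : Type*} [AddCommGroup W] [Module k W] {Z : Type*} [AddCommGroup Z] [Module k Z]

/-- Morphisms of `𝒟`: linear maps which preserve degrees and commute with the `X`-action. -/
def IsHom (A : DObj C k V) (B : DObj C k W) (f : V →ₗ[k] W) : Prop :=
  (∀ y v, f (A.proj y v) = B.proj y (f v)) ∧ ∀ x v, f (A.act x v) = B.act x (f v)

theorem proj_of_mem (A : DObj C k V) {a : X} {v : V} (h : A.proj a v = v) (y : X) :
    A.proj y v = if y = a then v else 0 := by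
  rw [← h, A.proj_proj]

theorem act_of_mem (A : DObj C k V) {a : X} {v : V} (h : A.proj a v = v) (x : X) :
    A.proj (C.conj a x) (A.act x v) = A.act x v := by
  rw [← A.act_proj, h]

/-- Two linear maps on `V ⊗ W` agree if they agree on tensors of homogeneous elements. -/
theorem tensor_ext (A : DObj C k V) (B : DObj C k W) {f g : V ⊗[k] W →ₗ[k] Z}
    (h : ∀ a b v w, A.proj a v = v → B.proj b w = w → f (v ⊗ₜ w) = g (v ⊗ₜ w)) : f = g := by
  refine TensorProduct.ext' fun v w => ?_
  have hv := A.sum_proj v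
  have hw := B.sum_proj w
  rw [← hv, ← hw]
  simp only [TensorProduct.sum_tmul, TensorProduct.tmul_sum, map_sum]
  exact Finset.sum_congr rfl fun b _ => Finset.sum_congr rfl fun a _ =>
    h a b _ _ (by rw [A.proj_proj, if_pos rfl]) (by rw [B.proj_proj, if_pos rfl])

open TensorProduct in
/-- The projection of `V ⊗ W` onto the component of degree `y`, where
`‖ξ ⊗ η‖ = ‖ξ‖ ∘ ‖η‖`. -/
noncomputable def tensorProj (A : DObj C k V) (B : DObj C k W) (y : X) :
    V ⊗[k] W →ₗ[k] V ⊗[k] W :=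
  ∑ p : X × X with C.circ p.1 p.2 = y, map (A.proj p.1) (B.proj p.2)

open TensorProduct in
/-- The action of `x` on `V ⊗ W`: `(ξ ⊗ η) ◁^ x = ξ ◁^ (‖η‖ ▷~ x) ⊗ η ◁^ x`. -/
noncomputable def tensorAct (A : DObj C k V) (B : DObj C k W) (x : X) :
    V ⊗[k] W →ₗ[k] V ⊗[k] W :=
  ∑ b, map (A.act (C.lact b x)) (B.act x ∘ₗ B.proj b)

theorem tensorProj_tmul (A : DObj C k V) (B : DObj C k W) (y : X) {a b : X} {v : V} {w : W}
    (hv : A.proj a v = v) (hw : B.proj b w = w) :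
    tensorProj A B y (v ⊗ₜ w) = if y = C.circ a b then v ⊗ₜ[k] w else 0 := by
  have key : ∀ p : X × X, A.proj p.1 v ⊗ₜ[k] B.proj p.2 w
      = if p = (a, b) then v ⊗ₜ[k] w else 0 := by
    rintro ⟨p, q⟩
    simp only [A.proj_of_mem hv, B.proj_of_mem hw, Prod.mk.injEq]
    split_ifs <;> simp_all
  simp only [tensorProj, LinearMap.sum_apply, TensorProduct.map_tmul, key]
  rw [Finset.sum_ite_eq']
  simp [eq_comm]

theorem tensorAct_tmul (A : DObj C k V) (B : DObj C k W) (x : X) {b : X} (v : V) {w : W}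
    (hw : B.proj b w = w) :
    tensorAct A B x (v ⊗ₜ w) = A.act (C.lact b x) v ⊗ₜ[k] B.act x w := by
  simp only [tensorAct, LinearMap.sum_apply, TensorProduct.map_tmul, LinearMap.comp_apply]
  rw [Finset.sum_eq_single b]
  · rw [hw]
  · intro c _ hc
    rw [B.proj_of_mem hw, if_neg hc]; simp
  · simp

/-- The tensor product of `𝒟`. -/
noncomputable def tensor (A : DObj C k V) (B : DObj C k W) : DObj C k (V ⊗[k] W) where
  proj := tensorProj A B
  act := tensorAct A B
  proj_proj y z v := by
    have : tensorProj A B y ∘ₗ tensorProj A B z = if y = z then tensorProj A B z else 0 := by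
      refine tensor_ext A B fun a b v w hv hw => ?_
      rw [LinearMap.comp_apply, tensorProj_tmul A B z hv hw]
      by_cases h : z = C.circ a b
      · rw [if_pos h, tensorProj_tmul A B y hv hw]
        split_ifs <;> simp_all [tensorProj_tmul A B _ hv hw]
      · rw [if_neg h, map_zero]
        split_ifs <;> simp_all [tensorProj_tmul A B _ hv hw]
    have h := LinearMap.congr_fun this v
    rw [LinearMap.comp_apply] at h
    rw [h]; split_ifs <;> rfl
  sum_proj v := by
    have : ∑ y, tensorProj A B y = LinearMap.id := by
      refine tensor_ext A B fun a b v w hv hw => ?_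
      simp [LinearMap.sum_apply, tensorProj_tmul A B _ hv hw]
    simpa using LinearMap.congr_fun this v
  act_one v := by
    have : tensorAct A B 1 = LinearMap.id := by
      refine tensor_ext A B fun a b v w hv hw => ?_
      simp [tensorAct_tmul A B 1 v hw, A.act_one, B.act_one, C.lact_one]
    simpa using LinearMap.congr_fun this v
  act_mul x y v := by
    have : tensorAct A B (x * y) = tensorAct A B y ∘ₗ tensorAct A B x := by
      refine tensor_ext A B fun a b v w hv hw => ?_
      rw [LinearMap.comp_apply, tensorAct_tmul A B _ v hw, tensorAct_tmul A B _ v hw,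
        tensorAct_tmul A B _ _ (B.act_of_mem hw x), C.lact_mul, A.act_mul, B.act_mul]
    simpa using LinearMap.congr_fun this v
  act_proj x y v := by
    have : tensorAct A B x ∘ₗ tensorProj A B y =
        tensorProj A B (C.conj y x) ∘ₗ tensorAct A B x := by
      refine tensor_ext A B fun a b v w hv hw => ?_
      rw [LinearMap.comp_apply, LinearMap.comp_apply, tensorProj_tmul A B y hv hw,
        tensorAct_tmul A B _ v hw, tensorProj_tmul A B _ (A.act_of_mem hv _) (B.act_of_mem hw x),
        ← C.conj_circ]
      have : C.conj y x = C.conj (C.circ a b) x ↔ y = C.circ a b := by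
        simp [CosetData.conj]
      simp only [this]
      split_ifs
      · exact tensorAct_tmul A B _ v hw
      · simp
    simpa using LinearMap.congr_fun this v

open TensorProduct in
/-- The associator `Φ : (V ⊗ W) ⊗ Z → V ⊗ (W ⊗ Z)`,
`Φ((ξ ⊗ η) ⊗ ζ) = ξ ◁^ τ(⟨η⟩, ⟨ζ⟩) ⊗ (η ⊗ ζ)`. -/
noncomputable def associator (A : DObj C k V) (B : DObj C k W) (E : DObj C k Z) :
    (V ⊗[k] W) ⊗[k] Z →ₗ[k] V ⊗[k] (W ⊗[k] Z) :=
  (∑ p : X × X, map (A.act (C.tau p.1 p.2)) (map (B.proj p.1) (E.proj p.2))) ∘ₗ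
    (TensorProduct.assoc k V W Z).toLinearMap

open TensorProduct in
/-- The inverse associator,
`Φ⁻¹(ξ ⊗ (η ⊗ ζ)) = (ξ ◁^ τ(⟨η⟩, ⟨ζ⟩)⁻¹ ⊗ η) ⊗ ζ`. -/
noncomputable def associatorInv (A : DObj C k V) (B : DObj C k W) (E : DObj C k Z) :
    V ⊗[k] (W ⊗[k] Z) →ₗ[k] (V ⊗[k] W) ⊗[k] Z :=
  (TensorProduct.assoc k V W Z).symm.toLinearMap ∘ₗ
    ∑ p : X × X, map (A.act (C.tau p.1 p.2)⁻¹) (map (B.proj p.1) (E.proj p.2))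

open TensorProduct in
/-- The braiding `Ψ(ξ ⊗ η) = η ◁^ (⟨ξ⟩ ◁ |η|)⁻¹ ⊗ ξ ◁^ |η|`, where `s u = (s ▷ u) (s ◁ u)` with
`s ▷ u ∈ G` and `s ◁ u ∈ M`. -/
noncomputable def braiding (A : DObj C k V) (B : DObj C k W) : V ⊗[k] W →ₗ[k] W ⊗[k] V :=
  (∑ p : X × X, map (B.act (C.rep (C.rep p.1 * C.abs p.2))⁻¹ ∘ₗ B.proj p.2)
    (A.act (C.abs p.2) ∘ₗ A.proj p.1)) ∘ₗ (TensorProduct.comm k V W).toLinearMap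

theorem braiding_tmul (A : DObj C k V) (B : DObj C k W) {a b : X} {v : V} {w : W}
    (hv : A.proj a v = v) (hw : B.proj b w = w) : braiding A B (v ⊗ₜ w) =
      B.act (C.rep (C.rep a * C.abs b))⁻¹ w ⊗ₜ A.act (C.abs b) v := by
  simp only [braiding, LinearMap.comp_apply, LinearEquiv.coe_coe, TensorProduct.comm_tmul,
    LinearMap.sum_apply, TensorProduct.map_tmul]
  rw [Finset.sum_eq_single (a, b)]
  · rw [hv, hw]
  · rintro ⟨p, q⟩ _ hpq
    rw [A.proj_of_mem hv, B.proj_of_mem hw]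
    split_ifs <;> simp_all
  · simp

theorem associator_tmul (A : DObj C k V) (B : DObj C k W) (E : DObj C k Z) {b c : X} (v : V)
    {w : W} {z : Z} (hw : B.proj b w = w) (hz : E.proj c z = z) :
    associator A B E ((v ⊗ₜ w) ⊗ₜ z) = A.act (C.tau b c) v ⊗ₜ[k] (w ⊗ₜ[k] z) := by
  simp only [associator, LinearMap.comp_apply, LinearEquiv.coe_coe, TensorProduct.assoc_tmul,
    LinearMap.sum_apply, TensorProduct.map_tmul]
  rw [Finset.sum_eq_single (b, c)]
  · rw [hw, hz]
  · rintro ⟨p, q⟩ _ hpq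
    rw [B.proj_of_mem hw, E.proj_of_mem hz]
    split_ifs <;> simp_all
  · simp

theorem associatorInv_tmul (A : DObj C k V) (B : DObj C k W) (E : DObj C k Z) {b c : X} (v : V)
    {w : W} {z : Z} (hw : B.proj b w = w) (hz : E.proj c z = z) :
    associatorInv A B E (v ⊗ₜ (w ⊗ₜ z)) = (A.act (C.tau b c)⁻¹ v ⊗ₜ[k] w) ⊗ₜ[k] z := by
  simp only [associatorInv, LinearMap.comp_apply, LinearEquiv.coe_coe,
    LinearMap.sum_apply, TensorProduct.map_tmul]
  rw [Finset.sum_eq_single (b, c)]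
  · rw [hw, hz, TensorProduct.assoc_symm_tmul]
  · rintro ⟨p, q⟩ _ hpq
    rw [B.proj_of_mem hw, E.proj_of_mem hz]
    split_ifs <;> simp_all
  · simp

end DObj

/-! ### The braided Hopf algebra `D` -/

/-- The underlying vector space of `D`, with basis the elements `δ_y ⊗ x = e (y, x)`. -/
abbrev DAlg (X k : Type*) [Zero k] := X × X →₀ k

namespace DAlg

variable {X : Type*} [Group X] [Fintype X] [DecidableEq X] (C : CosetData X)
  (k : Type*) [Field k]

/-- The basis element `δ_y ⊗ x`, for `d = (y, x)`. -/
noncomputable def e (d : X × X) : DAlg X k := Finsupp.single d 1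

/-- `(δ_y ⊗ x) ◁^ z = δ_{y ◁~ (a ▷~ z)} ⊗ (a ▷~ z)⁻¹ x z` with `a = ‖δ_y ⊗ x‖`. -/
noncomputable def actBasis (z : X) (d : X × X) : X × X :=
  (C.conj d.1 (C.lact (C.deg d) z), (C.lact (C.deg d) z)⁻¹ * d.2 * z)

theorem deg_actBasis (z : X) (d : X × X) : C.deg (actBasis C z d) = C.conj (C.deg d) z := by
  refine C.deg_eq ?_
  have h := congrArg (fun t => C.conj t z) (C.circ_deg d)
  simp only [C.conj_circ] at h
  simp only [actBasis]
  rw [h]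
  simp only [CosetData.conj]; group

/-- `D` as an object of `𝒟`. -/
noncomputable def obj : DObj C k (DAlg X k) where
  proj y := Finsupp.linearCombination k fun d => if C.deg d = y then e k d else 0
  act z := Finsupp.linearCombination k fun d => e k (actBasis C z d)
  proj_proj y z v := by
    induction v using Finsupp.induction_linear with
    | zero => simp
    | add a b ha hb => simp only [map_add, ha, hb]; split_ifs <;> simp
    | single d c =>
      simp only [Finsupp.linearCombination_single, map_smul]
      by_cases h : C.deg d = z
      · subst h
        by_cases h' : y = C.deg d
        · simp [h', e]
        · simp [h', e, Ne.symm h']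
      · simp [h]
  sum_proj v := by
    induction v using Finsupp.induction_linear with
    | zero => simp
    | add a b ha hb => simp only [map_add, Finset.sum_add_distrib, ha, hb]
    | single d c => simp [e]
  act_one v := by
    induction v using Finsupp.induction_linear with
    | zero => simp
    | add a b ha hb => simp only [map_add, ha, hb]
    | single d c => simp [e, actBasis, C.lact_one, C.conj_one]
  act_mul x y v := by
    induction v using Finsupp.induction_linear with
    | zero => simp
    | add a b ha hb => simp only [map_add, ha, hb]
    | single d c =>
      have : actBasis C (x * y) d = actBasis C y (actBasis C x d) := by
        rw [actBasis, actBasis, deg_actBasis, C.lact_mul]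
        simp only [actBasis, CosetData.conj]
        ext <;> group
      simp [e, this]
  act_proj x y v := by
    induction v using Finsupp.induction_linear with
    | zero => simp
    | add a b ha hb => simp only [map_add, ha, hb]
    | single d c =>
      have : C.conj (C.deg d) x = C.conj y x ↔ C.deg d = y := by simp [CosetData.conj]
      simp only [e, Finsupp.linearCombination_single, map_smul, one_smul, deg_actBasis, this]
      split_ifs <;> simp

/-- The product `(δ_y ⊗ x)(δ_w ⊗ z) = δ_{w, y ◁~ x} δ_{y ◁~ τ~(a, b)} ⊗ τ~(a, b)⁻¹ x z`, where
`a = ‖δ_y ⊗ x‖` and `b = ‖δ_w ⊗ z‖`. -/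
noncomputable def mul : DAlg X k ⊗[k] DAlg X k →ₗ[k] DAlg X k :=
  TensorProduct.lift <| Finsupp.linearCombination k fun d => Finsupp.linearCombination k fun f =>
    let t := C.tau (C.deg d) (C.deg f)
    if f.1 = C.conj d.1 d.2 then e k (C.conj d.1 t, t⁻¹ * d.2 * f.2) else 0

/-- The unit `1 = ∑_y δ_y ⊗ e`. -/
noncomputable def one : DAlg X k := ∑ y : X, e k (y, 1)

/-- The counit `ε(δ_y ⊗ x) = δ_{y, e}`. -/
noncomputable def counit : DAlg X k →ₗ[k] k :=
  Finsupp.linearCombination k fun d => if d.1 = 1 then 1 else 0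

/-- The coproduct of `d = δ_y ⊗ x` is the sum over `b : X` of `comulFst d b ⊗ comulSnd d b`, basis
elements of degrees `w = degFst d b` and `v = degSnd d b` with `w ∘ v = c`, where `c = ‖δ_y ⊗ x‖`.
Here `v = |c|⁻¹ b⁻¹ |c| x⁻¹ b x`; in the action on `ξ ⊗ η` only the summand `b = ‖η‖` matters. -/
noncomputable def degSnd (d : X × X) (b : X) : X :=
  (C.abs (C.deg d))⁻¹ * b⁻¹ * C.abs (C.deg d) * (d.2⁻¹ * b * d.2)

/-- `w = |v| c ⟨v⟩⁻¹`, the solution of `w ∘ v = c`. -/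
noncomputable def degFst (d : X × X) (b : X) : X :=
  C.abs (degSnd C d b) * C.deg d * (C.rep (degSnd C d b))⁻¹

/-- `g = |v| |c|⁻¹`. -/
noncomputable def shift (d : X × X) (b : X) : X := C.abs (degSnd C d b) * (C.abs (C.deg d))⁻¹

/-- The second factor, `δ_{b'} ⊗ g x` with `b' = g b g⁻¹`. -/
noncomputable def comulSnd (d : X × X) (b : X) : X × X :=
  (shift C d b * b * (shift C d b)⁻¹, shift C d b * d.2)

/-- The first factor, `δ_{|w| b'⁻¹ (g y g⁻¹) |w|⁻¹} ⊗ |w| b'⁻¹ g x |v|⁻¹ b'`. -/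
noncomputable def comulFst (d : X × X) (b : X) : X × X :=
  (C.abs (degFst C d b) * (comulSnd C d b).1⁻¹ * (shift C d b * d.1 * (shift C d b)⁻¹) *
      (C.abs (degFst C d b))⁻¹,
    C.abs (degFst C d b) * (comulSnd C d b).1⁻¹ * shift C d b * d.2 *
      (C.abs (degSnd C d b))⁻¹ * (comulSnd C d b).1)

/-- The coproduct of `D`: the coproduct which induces the canonical action on tensor products of
objects of `𝒟`, see `DObj.tensorRep_eq`. -/
noncomputable def comul : DAlg X k →ₗ[k] DAlg X k ⊗[k] DAlg X k :=
  Finsupp.linearCombination k fun d => ∑ b : X, e k (comulFst C d b) ⊗ₜ[k] e k (comulSnd C d b)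

/-- `⟨w⟩ (x⁻¹ y x)⁻¹ ⟨w⟩⁻¹` and `⟨w⟩ x⁻¹ |w|`, where `w = ‖δ_y ⊗ x‖`. -/
noncomputable def antipodeBasis (d : X × X) : X × X :=
  (C.rep (C.deg d) * (d.2⁻¹ * d.1 * d.2)⁻¹ * (C.rep (C.deg d))⁻¹,
    C.rep (C.deg d) * d.2⁻¹ * C.abs (C.deg d))

/-- The antipode `S(δ_y ⊗ x) = δ_{⟨w⟩ (x⁻¹ y x)⁻¹ ⟨w⟩⁻¹} ⊗ ⟨w⟩ x⁻¹ |w|`, `w = ‖δ_y ⊗ x‖`, which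
satisfies `μ ∘ (S ⊗ id) ∘ Δ = η ∘ ε`, see `DAlg.antipode_mul`. -/
noncomputable def antipode : DAlg X k →ₗ[k] DAlg X k :=
  Finsupp.linearCombination k fun d => e k (antipodeBasis C d)

/-- `Λ ∈ D` is a right integral: `Λ ≠ 0` and `Λ h = ε(h) Λ` for all `h ∈ D`. -/
def IsRightIntegral (L : DAlg X k) : Prop :=
  L ≠ 0 ∧ ∀ h : DAlg X k, mul C k (L ⊗ₜ h) = counit k h • L

theorem proj_e (y : X) (d : X × X) :
    (obj C k).proj y (e k d) = if C.deg d = y then e k d else 0 := by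
  simp [obj, e]

theorem act_e (z : X) (d : X × X) : (obj C k).act z (e k d) = e k (actBasis C z d) := by
  simp [obj, e]

theorem mul_e (d f : X × X) : mul C k (e k d ⊗ₜ e k f) =
    if f.1 = C.conj d.1 d.2 then e k (C.conj d.1 (C.tau (C.deg d) (C.deg f)),
      (C.tau (C.deg d) (C.deg f))⁻¹ * d.2 * f.2) else 0 := by
  simp [mul, e]

theorem proj_deg (d : X × X) : (obj C k).proj (C.deg d) (e k d) = e k d := by
  simp [proj_e]

variable {C k} in
theorem tensor_ext {V : Type*} [AddCommGroup V] [Module k V] {Z : Type*} [AddCommGroup Z]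
    [Module k Z] (A : DObj C k V) {f g : V ⊗[k] DAlg X k →ₗ[k] Z}
    (h : ∀ a v d, A.proj a v = v → f (v ⊗ₜ e k d) = g (v ⊗ₜ e k d)) : f = g := by
  refine TensorProduct.ext' fun v x => ?_
  have hv := A.sum_proj v
  rw [← hv]
  induction x using Finsupp.induction_linear with
  | zero => simp
  | add a b ha hb => simp only [TensorProduct.tmul_add, map_add, ha, hb]
  | single d c =>
    have : Finsupp.single d c = c • e k d := by simp [e]
    rw [this]
    simp only [TensorProduct.sum_tmul, map_sum, TensorProduct.tmul_smul, map_smul]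
    refine congrArg (c • ·) (Finset.sum_congr rfl fun a _ => ?_)
    exact h a _ d (by rw [A.proj_proj, if_pos rfl])

/-- The canonical action `ξ (δ_y ⊗ x) = δ_{y, ‖ξ‖} ξ ◁^ x` of `D` on an object of `𝒟`. -/
noncomputable def canonicalAct {C : CosetData X} {k : Type*} [Field k] {V : Type*}
    [AddCommGroup V] [Module k V] (A : DObj C k V) : V ⊗[k] DAlg X k →ₗ[k] V :=
  TensorProduct.lift (LinearMap.flip
    (Finsupp.linearCombination k fun d : X × X => A.act d.2 ∘ₗ A.proj d.1))

variable {C k} in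
theorem canonicalAct_tmul {V : Type*} [AddCommGroup V] [Module k V] (A : DObj C k V) (v : V)
    (d : X × X) : canonicalAct A (v ⊗ₜ e k d) = A.act d.2 (A.proj d.1 v) := by
  simp [canonicalAct, e]

theorem comul_e (d : X × X) : comul C k (e k d) =
    ∑ b, e k (comulFst C d b) ⊗ₜ[k] e k (comulSnd C d b) := by
  simp [comul, e]

theorem deg_eq_word (d : X × X) :
    C.deg d = (C.abs (C.deg d))⁻¹ * d.1⁻¹ * C.abs (C.deg d) * (d.2⁻¹ * d.1 * d.2) := by
  have h := C.circ_deg d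
  rw [C.circ_eq, C.rep_eq, CosetData.conj] at h
  rw [← h]; group

theorem deg_comulSnd (d : X × X) (b : X) : C.deg (comulSnd C d b) = degSnd C d b := by
  refine C.deg_eq ?_
  rw [C.circ_eq, C.rep_eq]
  simp only [comulSnd, CosetData.conj, shift]
  generalize C.abs (degSnd C d b) = V
  simp only [degSnd]
  group

theorem circ_degFst_degSnd (d : X × X) (b : X) :
    C.circ (degFst C d b) (degSnd C d b) = C.deg d := by
  rw [C.circ_eq, degFst]; group

theorem tau_degFst_degSnd (d : X × X) (b : X) :
    C.tau (degFst C d b) (degSnd C d b) = C.abs (degFst C d b) * shift C d b := by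
  rw [C.tau_eq, circ_degFst_degSnd, shift, mul_assoc]

theorem deg_comulFst (d : X × X) (b : X) : C.deg (comulFst C d b) = degFst C d b := by
  refine C.deg_eq ?_
  rw [C.circ_eq, C.rep_eq]
  simp only [comulFst, comulSnd, CosetData.conj, shift]
  generalize C.abs (degFst C d b) = Q
  simp only [degFst, C.rep_eq (degSnd C d b)]
  generalize C.abs (degSnd C d b) = V
  simp only [degSnd]
  have h := deg_eq_word C d
  generalize C.abs (C.deg d) = A at h ⊢
  rw [h]
  group

theorem counit_e (d : X × X) : counit k (e k d) = if d.1 = 1 then 1 else 0 := by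
  simp [counit, e]

theorem antipode_e (d : X × X) : antipode C k (e k d) = e k (antipodeBasis C d) := by
  simp [antipode, e]

theorem deg_antipodeBasis (d : X × X) : C.deg (antipodeBasis C d) = C.deg d := by
  refine C.deg_eq ?_
  have h := deg_eq_word C d
  rw [C.circ_eq]
  simp only [antipodeBasis, CosetData.conj, C.rep_eq (C.deg d)]
  generalize C.abs (C.deg d) = A at h ⊢
  rw [h]
  group

theorem deg_of_fst_eq_one {d : X × X} (h : d.1 = 1) : C.deg d = 1 := by
  have := deg_eq_word C d
  rw [this, h]; group

theorem abs_one : C.abs 1 = 1 := by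
  have := (C.rep_abs_mul C.G.one_mem C.one_mem).2
  simpa using this

theorem antipode_mul (d : DAlg X k) :
    mul C k ((antipode C k).rTensor _ (comul C k d)) = counit k d • one k := by
  induction d using Finsupp.induction_linear with
  | zero => simp
  | add a b ha hb => simp only [map_add, ha, hb, add_smul]
  | single d c =>
    have : Finsupp.single d c = c • e k d := by simp [e]
    simp only [this, map_smul, smul_assoc]
    congr 1
    simp only [comul_e, map_sum, LinearMap.rTensor_tmul, antipode_e, mul_e, deg_antipodeBasis,
      deg_comulFst, deg_comulSnd, tau_degFst_degSnd, counit_e]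
    by_cases h : d.1 = 1
    · simp only [h, if_true, one_smul]
      have key : ∀ b, (comulSnd C d b).1 = C.conj (antipodeBasis C (comulFst C d b)).1
            (antipodeBasis C (comulFst C d b)).2 ∧
          (C.conj (antipodeBasis C (comulFst C d b)).1
            (C.abs (degFst C d b) * shift C d b),
          (C.abs (degFst C d b) * shift C d b)⁻¹ * (antipodeBasis C (comulFst C d b)).2 *
            (comulSnd C d b).2) = (d.2⁻¹ * b * d.2, 1) := by
        intro b
        have hc := deg_of_fst_eq_one C h
        have ha := abs_one C
        simp only [antipodeBasis, deg_comulFst, C.rep_eq (degFst C d b)]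
        simp only [CosetData.conj, comulFst, comulSnd, h, shift, hc, ha]
        generalize C.abs (degFst C d b) = Q
        simp only [degFst, C.rep_eq (degSnd C d b), hc]
        generalize C.abs (degSnd C d b) = V
        simp only [degSnd, hc, ha, Prod.mk.injEq]
        refine ⟨?_, ?_, ?_⟩ <;> group
      simp only [if_pos (key _).1, (key _).2, one]
      exact Fintype.sum_equiv (MulAut.conj d.2⁻¹).toEquiv _ _ fun b => by simp
    · rw [if_neg h, zero_smul]
      refine Finset.sum_eq_zero fun b _ => if_neg fun h' => h ?_
      simp only [antipodeBasis, deg_comulFst, CosetData.conj] at h'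
      simp only [comulFst, comulSnd, C.rep_eq (degFst C d b)] at h'
      generalize C.abs (degFst C d b) = Q at h'
      generalize shift C d b = g at h'
      have h2 : g * b * g⁻¹ = g * d.1⁻¹ * b * g⁻¹ := by
        conv_lhs => rw [h']
        group
      have h3 : b = d.1⁻¹ * b := by simpa [mul_assoc] using h2
      simpa using h3

end DAlg

namespace DObj

variable {X : Type*} [Group X] [Fintype X] [DecidableEq X] {C : CosetData X}
  {k : Type*} [Field k] {V : Type*} [AddCommGroup V] [Module k V]
  {W : Type*} [AddCommGroup W] [Module k W]

/-- The action of `D` on a tensor product, through its coproduct. -/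
noncomputable def tensorRep (A : DObj C k V) (B : DObj C k W) :
    (V ⊗[k] W) ⊗[k] DAlg X k →ₗ[k] V ⊗[k] W :=
  TensorProduct.map (DAlg.canonicalAct A) (DAlg.canonicalAct B) ∘ₗ
  A.associatorInv (DAlg.obj C k) (B.tensor (DAlg.obj C k)) ∘ₗ
  ((DAlg.obj C k).associator B (DAlg.obj C k)).lTensor V ∘ₗ
  ((B.braiding (DAlg.obj C k)).rTensor (DAlg X k)).lTensor V ∘ₗ
  (B.associatorInv (DAlg.obj C k) (DAlg.obj C k)).lTensor V ∘ₗ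
  A.associator B ((DAlg.obj C k).tensor (DAlg.obj C k)) ∘ₗ
  (DAlg.comul C k).lTensor (V ⊗[k] W)

theorem tensor_proj_tmul (A : DObj C k V) (B : DObj C k W) {a b : X} {v : V} {w : W}
    (hv : A.proj a v = v) (hw : B.proj b w = w) :
    (A.tensor B).proj (C.circ a b) (v ⊗ₜ w) = v ⊗ₜ w := by
  change tensorProj A B _ _ = _
  rw [tensorProj_tmul A B _ hv hw, if_pos rfl]

open DAlg in
theorem actBasis_mul (x y : X) (d : X × X) :
    actBasis C (x * y) d = actBasis C y (actBasis C x d) := by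
  rw [actBasis, actBasis, deg_actBasis, C.lact_mul]
  simp only [actBasis, CosetData.conj]
  ext <;> group

open DAlg in
theorem comul_key {C : CosetData X} (d : X × X) (b a : X) (r : X)
    (hr : r = (C.rep (C.conj b (shift C d b)⁻¹))⁻¹ *
      C.tau (C.conj b (shift C d b)⁻¹) (degSnd C d b)) (t : X)
    (ht : t = C.tau b (C.deg d) * (C.tau (C.deg (actBasis C r (comulFst C d b)))
      (C.circ (C.conj b (shift C d b)⁻¹) (degSnd C d b)))⁻¹) :
    ((actBasis C r (comulFst C d b)).1 = C.conj a t ↔ d.1 = C.circ a b) ∧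
      t * (actBasis C r (comulFst C d b)).2 = C.lact b d.2 := by
  have hc := deg_eq_word C d
  have h1 : C.circ (C.conj b (shift C d b)⁻¹) (degSnd C d b) = C.conj b d.2 := by
    rw [C.circ_eq, C.rep_eq]
    simp only [shift, CosetData.conj]
    generalize C.abs (degSnd C d b) = V
    simp only [degSnd]
    group
  have hr' : r = (C.conj b (shift C d b)⁻¹)⁻¹ * C.abs (degSnd C d b) *
      (C.abs (C.conj b d.2))⁻¹ := by
    rw [hr, C.tau_eq, h1, C.rep_eq]; group
  have h2 : C.circ (C.conj (degFst C d b) r) (C.conj b d.2) = C.circ b (C.deg d) := by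
    rw [hr', C.circ_eq, C.circ_eq, C.rep_eq, C.rep_eq]
    generalize C.abs (C.conj b d.2) = B'
    simp only [shift, CosetData.conj, degFst, C.rep_eq (degSnd C d b)]
    generalize C.abs (degSnd C d b) = V
    simp only [degSnd]
    generalize C.abs (C.deg d) = A at hc ⊢
    rw [hc]
    group
  have ht' : t = C.abs b * C.abs (C.deg d) * (C.abs (C.conj b d.2))⁻¹ *
      (C.abs (C.conj (degFst C d b) r))⁻¹ := by
    rw [ht, h1, C.tau_eq, C.tau_eq, deg_actBasis, deg_comulFst, h2]; group
  have hl : C.lact (degFst C d b) r = C.abs (degFst C d b) * r *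
      (C.abs (C.conj (degFst C d b) r))⁻¹ := rfl
  simp only [actBasis, deg_comulFst, hl, ht']
  generalize C.abs (C.conj (degFst C d b) r) = P
  rw [CosetData.lact, hr']
  generalize C.abs (C.conj b d.2) = B'
  simp only [comulFst, comulSnd]
  generalize C.abs (degFst C d b) = Q
  simp only [shift, CosetData.conj]
  generalize C.abs (degSnd C d b) = V
  constructor
  · rw [C.circ_eq, C.rep_eq]
    generalize C.abs (C.deg d) = A at hc ⊢
    generalize C.abs b = Bb
    constructor
    · intro h
      have h' := congrArg (fun z => (P * B' * A⁻¹)⁻¹ * z * (P * B' * A⁻¹) * b) h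
      refine Eq.trans ?_ (h'.trans ?_) <;> group
    · intro h
      rw [h]; group
  · generalize C.abs (C.deg d) = A
    group

open DAlg in
theorem tensorRep_eq (A : DObj C k V) (B : DObj C k W) :
    tensorRep A B = DAlg.canonicalAct (A.tensor B) := by
  refine TensorProduct.ext' fun u d => ?_
  suffices h : ∀ d : X × X, tensorRep A B ∘ₗ (TensorProduct.mk k _ (DAlg X k)).flip (e k d) =
      DAlg.canonicalAct (A.tensor B) ∘ₗ (TensorProduct.mk k _ (DAlg X k)).flip (e k d) by
    induction d using Finsupp.induction_linear with
    | zero => simp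
    | add a b ha hb => simp only [TensorProduct.tmul_add, map_add, ha, hb]
    | single d c =>
      have hs : Finsupp.single d c = c • e k d := by simp [e]
      simp only [hs, TensorProduct.tmul_smul, map_smul]
      congr 1
      exact LinearMap.congr_fun (h d) u
  intro d
  refine tensor_ext A B fun a b v w hv hw => ?_
  simp only [LinearMap.comp_apply, LinearMap.flip_apply, TensorProduct.mk_apply]
  rw [canonicalAct_tmul]
  change _ = tensorAct A B d.2 (tensorProj A B d.1 _)
  rw [tensorProj_tmul A B _ hv hw]
  simp only [tensorRep, LinearMap.comp_apply, LinearMap.lTensor_tmul, comul_e,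
    TensorProduct.tmul_sum, map_sum]
  have step : ∀ β : X, (TensorProduct.map (DAlg.canonicalAct A) (DAlg.canonicalAct B))
      (A.associatorInv (DAlg.obj C k) (B.tensor (DAlg.obj C k))
      (((DAlg.obj C k).associator B (DAlg.obj C k)).lTensor V
      (((B.braiding (DAlg.obj C k)).rTensor (DAlg X k)).lTensor V
      ((B.associatorInv (DAlg.obj C k) (DAlg.obj C k)).lTensor V
      (A.associator B ((DAlg.obj C k).tensor (DAlg.obj C k))
        ((v ⊗ₜ w) ⊗ₜ (e k (comulFst C d β) ⊗ₜ e k (comulSnd C d β)))))))) =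
      if β = b then (if d.1 = C.circ a b then tensorAct A B d.2 (v ⊗ₜ w) else 0) else 0 := by
    intro β
    have h1 := proj_deg C k (comulFst C d β)
    have h2 := proj_deg C k (comulSnd C d β)
    have h12 := tensor_proj_tmul _ _ h1 h2
    rw [deg_comulFst, deg_comulSnd, circ_degFst_degSnd] at h12
    rw [deg_comulFst] at h1
    rw [deg_comulSnd] at h2
    rw [associator_tmul A B _ v hw h12, LinearMap.lTensor_tmul, associatorInv_tmul B _ _ w h1 h2,
      LinearMap.lTensor_tmul, LinearMap.rTensor_tmul, braiding_tmul _ _ (B.act_of_mem hw _) h1,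
      LinearMap.lTensor_tmul]
    rw [associator_tmul _ _ _ _ (B.act_of_mem (B.act_of_mem hw _) _) h2]
    have hb2 : C.conj (C.conj b (C.tau (degFst C d β) (degSnd C d β))⁻¹) (C.abs (degFst C d β))
        = C.conj b (shift C d β)⁻¹ := by
      rw [tau_degFst_degSnd]; simp only [CosetData.conj]; group
    have h3 := B.act_of_mem (B.act_of_mem hw (C.tau (degFst C d β) (degSnd C d β))⁻¹)
      (C.abs (degFst C d β))
    rw [act_e, act_e, C.rep_rep_mul _ (C.abs_mem _), hb2, ← actBasis_mul]
    rw [hb2] at h3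
    rw [associatorInv_tmul A _ _ _ (proj_deg C k _) (tensor_proj_tmul B _ h3 h2),
      TensorProduct.map_tmul, canonicalAct_tmul, canonicalAct_tmul, B.proj_of_mem h3,
      tensorAct_tmul A B _ v hw]
    have h4 : (comulSnd C d β).1 = C.conj b (shift C d β)⁻¹ ↔ β = b := by
      simp [comulSnd, CosetData.conj]
    simp only [h4]
    by_cases hβ : β = b
    swap
    · simp [hβ]
    subst hβ
    simp only [if_true]
    rw [A.proj_of_mem (A.act_of_mem (A.act_of_mem hv _) _)]
    obtain ⟨hk1, hk2⟩ := comul_key (C := C) d β a _ rfl _ rfl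
    rw [← C.conj_mul]
    simp only [hk1]
    have hB : B.act (comulSnd C d β).2 (B.act (C.abs (degFst C d β))
        (B.act (C.tau (degFst C d β) (degSnd C d β))⁻¹ w)) = B.act d.2 w := by
      rw [← B.act_mul, ← B.act_mul, tau_degFst_degSnd]
      congr 2
      simp only [comulSnd]; group
    rw [hB]
    split_ifs
    · rw [← A.act_mul, ← A.act_mul, ← mul_assoc, hk2]
    · simp
  simp only [step]
  simp only [Finset.sum_ite_eq', Finset.mem_univ, if_true]
  split_ifs <;> simp

end DObj

/-! ### Right representations of `D` -/

section Representations

variable {X : Type*} [Group X] [Fintype X] [DecidableEq X]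

/-- A right representation of `D` in `𝒟` on the vector space `V`: an object of `𝒟` with a morphism
`ρ : V ⊗ D → V` of `𝒟` satisfying `ρ ∘ (ρ ⊗ id) = ρ ∘ (id ⊗ μ) ∘ Φ` and `ρ(ξ ⊗ 1) = ξ`. -/
structure RightRep (C : CosetData X) (k : Type*) [Field k] (V : Type*) [AddCommGroup V]
    [Module k V] where
  obj : DObj C k V
  ρ : V ⊗[k] DAlg X k →ₗ[k] V
  isHom : (obj.tensor (DAlg.obj C k)).IsHom obj ρ
  assoc : ρ ∘ₗ ρ.rTensor (DAlg X k) =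
    ρ ∘ₗ (DAlg.mul C k).lTensor V ∘ₗ obj.associator (DAlg.obj C k) (DAlg.obj C k)
  unit : ∀ v, ρ (v ⊗ₜ DAlg.one k) = v

namespace RightRep

variable {C : CosetData X} {k : Type*} [Field k] {V : Type*} [AddCommGroup V] [Module k V]
  {U : Type*} [AddCommGroup U] [Module k U]

open DAlg in
/-- Every object of `𝒟` is a right representation of `D`, with the canonical action. -/
noncomputable def canonical (A : DObj C k V) : RightRep C k V where
  obj := A
  ρ := canonicalAct A
  isHom := by
    constructor
    · intro y v
      have : canonicalAct A ∘ₗ (A.tensor (DAlg.obj C k)).proj y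
          = A.proj y ∘ₗ canonicalAct A := by
        refine DAlg.tensor_ext A fun a v d hv => ?_
        simp only [LinearMap.comp_apply, DObj.tensor]
        rw [DObj.tensorProj_tmul A _ y hv (proj_deg C k d), canonicalAct_tmul,
          A.proj_of_mem hv d.1]
        by_cases h : d.1 = a
        · subst h
          rw [if_pos rfl, A.proj_of_mem (A.act_of_mem hv _), C.circ_deg]
          split_ifs
          · rw [canonicalAct_tmul, hv]
          · simp
        · rw [if_neg h]
          split_ifs
          · rw [canonicalAct_tmul, A.proj_of_mem hv, if_neg h]; simp
          · simp
      simpa using LinearMap.congr_fun this v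
    · intro x v
      have : canonicalAct A ∘ₗ (A.tensor (DAlg.obj C k)).act x
          = A.act x ∘ₗ canonicalAct A := by
        refine DAlg.tensor_ext A fun a v d hv => ?_
        simp only [LinearMap.comp_apply, DObj.tensor]
        rw [DObj.tensorAct_tmul A _ x v (proj_deg C k d), act_e, canonicalAct_tmul,
          canonicalAct_tmul, actBasis]
        simp only
        rw [← A.act_proj, ← A.act_mul, ← A.act_mul]
        congr 2; group
      simpa using LinearMap.congr_fun this v
  assoc := by
    refine TensorProduct.ext_threefold fun v d f => ?_
    suffices h : ∀ d f : X × X, canonicalAct A (canonicalAct A (v ⊗ₜ e k d) ⊗ₜ e k f) =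
        canonicalAct A (A.act (C.tau (C.deg d) (C.deg f)) v ⊗ₜ mul C k (e k d ⊗ₜ e k f)) by
      have hsingle : ∀ (p : X × X) (c : k), Finsupp.single p c = c • e k p := fun p c => by
        simp [e]
      induction d using Finsupp.induction_linear with
      | zero => simp
      | add a b ha hb => simp only [TensorProduct.tmul_add, TensorProduct.add_tmul, map_add, ha, hb]
      | single d r =>
        induction f using Finsupp.induction_linear with
        | zero => simp
        | add a b ha hb => simp only [TensorProduct.tmul_add, map_add, ha, hb]
        | single f q =>
          simp only [hsingle, TensorProduct.tmul_smul, ← TensorProduct.smul_tmul', map_smul]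
          congr 2
          simp only [LinearMap.comp_apply, LinearMap.rTensor_tmul]
          rw [DObj.associator_tmul A _ _ v (proj_deg C k d) (proj_deg C k f),
            LinearMap.lTensor_tmul, h]
    intro d f
    rw [mul_e, canonicalAct_tmul, canonicalAct_tmul, A.act_proj d.2, A.proj_proj]
    split_ifs
    · rw [canonicalAct_tmul, ← A.act_proj, ← A.act_proj, ← A.act_mul, ← A.act_mul]
      simp [mul_assoc]
    · simp
  unit v := by
    simp [DAlg.one, TensorProduct.tmul_sum, canonicalAct_tmul, A.act_one, A.sum_proj]

/-- The action of `D` is the canonical one of the underlying object of `𝒟`: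
`ξ (δ_y ⊗ x) = δ_{y, ‖ξ‖} ξ ◁^ x`. -/
def IsCanonical (R : RightRep C k V) : Prop :=
  R.ρ = DAlg.canonicalAct R.obj

/-- Subrepresentations: subspaces which are graded, stable under the `X`-action (so that they are
subobjects in `𝒟`) and stable under `D`. -/
structure IsSubrep (R : RightRep C k V) (W : Submodule k V) : Prop where
  proj_mem : ∀ y, ∀ v ∈ W, R.obj.proj y v ∈ W
  act_mem : ∀ x, ∀ v ∈ W, R.obj.act x v ∈ W
  ρ_mem : ∀ d, ∀ v ∈ W, R.ρ (v ⊗ₜ d) ∈ W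

/-- Morphisms of right representations: morphisms of `𝒟` which commute with the actions of `D`. -/
def IsRepHom (R : RightRep C k V) (T : RightRep C k U) (f : V →ₗ[k] U) : Prop :=
  R.obj.IsHom T.obj f ∧ ∀ v d, f (R.ρ (v ⊗ₜ d)) = T.ρ (f v ⊗ₜ d)

/-- For a linear map `t : V → U` (not necessarily a morphism) the averaged map `t₀ : V → U`,
`V → V ⊗ D → V ⊗ (D ⊗ D) → V ⊗ (D ⊗ D) → (V ⊗ D) ⊗ D → V ⊗ D → U ⊗ D → U`, with arrows
`ξ ↦ ξ ⊗ Λ`, `id ⊗ Δ`, `id ⊗ (S ⊗ id)`, `Φ⁻¹`, `ρ ⊗ id`, `t ⊗ id`, `ρ`. -/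
noncomputable def average (R : RightRep C k V) (T : RightRep C k U) (L : DAlg X k)
    (t : V →ₗ[k] U) : V →ₗ[k] U :=
  T.ρ ∘ₗ t.rTensor (DAlg X k) ∘ₗ R.ρ.rTensor (DAlg X k) ∘ₗ
    R.obj.associatorInv (DAlg.obj C k) (DAlg.obj C k) ∘ₗ
    ((DAlg.antipode C k).rTensor (DAlg X k)).lTensor V ∘ₗ
    (DAlg.comul C k).lTensor V ∘ₗ (TensorProduct.mk k V (DAlg X k)).flip L

end RightRep

end Representations

/-! The whole statement reduces to the classical averaging argument for a finite group. Testing the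
integral against δ_e ⊗ z shows that its coefficients vanish off δ_e and are invariant under
translation, so Λ = c ∑ₓ δ_e ⊗ x with c |X| = 1 (`IsRightIntegral.exists_eq`). Hence |X| is
invertible in k. For any object of 𝒟, c ∑ x π_y p π_y x⁻¹, summed over y and x, then turns a linear
projection onto a subobject into a projection that is a morphism (`homAverage_isHom`,
`homAverage_isProj`).

The work lies in recognising p₀ as such an average. If D acts canonically, p₀ is the average over
the given grading and action of V, after a change of summation variables
(`average_eq_of_isCanonical`). For a general representation, D supplies a second structure of the
same type on V: the idempotents δ_y ⊗ e give a grading, and the elements δ ⊗ r, corrected by the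
given action so that associators and degrees cancel, give an honest action of X (`fiber`). The two
structures together determine the action of D (`basisAct_eq`). If p is a morphism of 𝒟, p₀ is its
average over the second structure (`average_eq_of_isHom`). It is still a morphism for the first one
(`isHom_homAverage_fiber`), hence commutes with D.

Starting from an arbitrary linear projection, the average over the first structure gives the
morphism of 𝒟, and averaging that one with Λ gives the complement. -/

/-! ### Averaging a linear map over a graded group action -/

namespace DObj

variable {X : Type*} [Group X] [Fintype X] [DecidableEq X] {C : CosetData X}
  {k : Type*} [Field k] {V : Type*} [AddCommGroup V] [Module k V]

/-- A linear map which preserves homogeneity of each degree commutes with the projections. -/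
theorem map_proj_of_forall_mem (A : DObj C k V) {f : V →ₗ[k] V}
    (h : ∀ g v, A.proj g v = v → A.proj g (f v) = f v) (y : X) (v : V) :
    f (A.proj y v) = A.proj y (f v) := by
  conv_rhs => rw [← A.sum_proj v]
  simp only [map_sum]
  rw [Finset.sum_eq_single y]
  · rw [h y _ (by rw [A.proj_proj, if_pos rfl])]
  · intro z _ hz
    rw [← h z (A.proj z v) (by rw [A.proj_proj, if_pos rfl]), A.proj_proj, if_neg (Ne.symm hz)]
  · simp

/-- The average `c ∑ₓ x p' x⁻¹` over the group action of the degree preserving part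
`p' = ∑_y π_y p π_y` of a linear map `p`. -/
noncomputable def homAverage (A : DObj C k V) (c : k) (p : V →ₗ[k] V) : V →ₗ[k] V :=
  c • ∑ q : X × X, A.act q.2 ∘ₗ A.proj q.1 ∘ₗ p ∘ₗ A.proj q.1 ∘ₗ A.act q.2⁻¹

theorem homAverage_apply (A : DObj C k V) (c : k) (p : V →ₗ[k] V) (v : V) :
    A.homAverage c p v =
      c • ∑ q : X × X, A.act q.2 (A.proj q.1 (p (A.proj q.1 (A.act q.2⁻¹ v)))) := by
  simp [homAverage]

theorem act_inv_act (A : DObj C k V) (x : X) (v : V) : A.act x (A.act x⁻¹ v) = v := by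
  rw [← A.act_mul, inv_mul_cancel, A.act_one]

/-- In a summand, x⁻¹ moves degree g to x g x⁻¹, the two projections force p to preserve that
degree, and x moves it back to g. Equivariance is the substitution x ↦ x z⁻¹ in the sum. -/
theorem homAverage_isHom (A : DObj C k V) (c : k) (p : V →ₗ[k] V) :
    A.IsHom A (A.homAverage c p) := by
  constructor
  · refine A.map_proj_of_forall_mem fun g v hv => ?_
    simp only [homAverage_apply, map_smul, map_sum]
    congr 1
    refine Finset.sum_congr rfl fun q _ => ?_
    have h1 := A.act_of_mem hv q.2⁻¹
    rw [A.proj_of_mem h1]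
    split_ifs with h
    · rw [h]
      have : C.conj (C.conj g q.2⁻¹) q.2 = g := by simp [CosetData.conj, mul_assoc]
      rw [A.act_proj q.2, this, A.proj_proj, if_pos rfl]
    · simp
  · intro x v
    simp only [homAverage_apply, map_smul, map_sum]
    congr 1
    refine Fintype.sum_equiv ((Equiv.refl X).prodCongr (Equiv.mulRight x⁻¹)) _ _ fun q => ?_
    simp only [Equiv.prodCongr_apply, Prod.map, Equiv.refl_apply, Equiv.coe_mulRight,
      ← A.act_mul]
    simp

/-- If `c |X| = 1`, the average of a projection onto a graded submodule which is stable under the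
group action is again a projection onto it. -/
theorem homAverage_isProj (A : DObj C k V) {c : k} (hc : c * Fintype.card X = 1)
    {p : V →ₗ[k] V} {W : Submodule k V} (hp : LinearMap.IsProj W p)
    (hproj : ∀ y, ∀ v ∈ W, A.proj y v ∈ W) (hact : ∀ x, ∀ v ∈ W, A.act x v ∈ W) :
    LinearMap.IsProj W (A.homAverage c p) := by
  constructor
  · intro v
    rw [homAverage_apply]
    exact W.smul_mem _ (W.sum_mem fun q _ => hact _ _ (hproj _ _ (hp.map_mem _)))
  · intro v hv
    -- On W every p acts as the identity, so summing over degrees restores the vector, x cancels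
    -- x⁻¹, and |X| equal terms remain.
    have : ∀ q : X × X, A.act q.2 (A.proj q.1 (p (A.proj q.1 (A.act q.2⁻¹ v)))) =
        A.act q.2 (A.proj q.1 (A.act q.2⁻¹ v)) := fun q => by
      rw [hp.map_id _ (hproj _ _ (hact _ _ hv)), A.proj_proj, if_pos rfl]
    simp only [homAverage_apply, this, Fintype.sum_prod_type_right, ← map_sum, A.sum_proj,
      A.act_inv_act]
    rw [Finset.sum_const, Finset.card_univ, ← Nat.cast_smul_eq_nsmul k, smul_smul, hc, one_smul]

end DObj

/-! ### Normalised right integrals -/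

namespace DAlg

variable {X : Type*} [Group X] [Fintype X] [DecidableEq X] {C : CosetData X}
  {k : Type*} [Field k]

theorem tau_one_left (C : CosetData X) (b : X) : C.tau 1 b = 1 := by
  have : C.circ 1 b = b := by rw [C.circ_eq, mul_one, C.abs_inv_mul_rep]
  rw [C.tau_eq, this, abs_one]; group

theorem circ_one (C : CosetData X) (a : X) : C.circ a 1 = a := by
  rw [C.circ_eq, C.rep_eq, abs_one]; group

theorem tau_one_right (C : CosetData X) (a : X) : C.tau a 1 = 1 := by
  rw [C.tau_eq, circ_one, abs_one]; group

theorem deg_eq_one_of_snd (C : CosetData X) (y : X) : C.deg (y, 1) = 1 :=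
  C.deg_eq (by rw [circ_one, C.conj_one])

theorem eq_sum_e (L : DAlg X k) : L = ∑ d, L d • e k d := by
  ext f
  simp [e]

/-- Elements δ_e ⊗ x have degree e, so τ is trivial and only the group multiplication remains. -/
theorem mul_e_one (L : DAlg X k) (z : X) :
    mul C k (L ⊗ₜ e k (1, z)) = ∑ x, L (1, x) • e k (1, x * z) := by
  conv_lhs => rw [eq_sum_e L]
  simp only [TensorProduct.sum_tmul, map_sum, ← TensorProduct.smul_tmul', map_smul, mul_e]
  rw [Fintype.sum_prod_type, Finset.sum_eq_single 1]
  · refine Finset.sum_congr rfl fun x _ => ?_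
    rw [if_pos (by simp [CosetData.conj]), deg_of_fst_eq_one C rfl, tau_one_left]
    simp [CosetData.conj]
  · intro y _ hy
    refine Finset.sum_eq_zero fun x _ => ?_
    rw [if_neg, smul_zero]
    intro h
    apply hy
    simp only [CosetData.conj] at h
    have : x * 1 * x⁻¹ = y := by rw [h]; group
    simpa using this.symm
  · simp

/-- A right integral with `ε(Λ) = 1` is `|X|⁻¹ ∑ₓ δ_e ⊗ x`. -/
theorem IsRightIntegral.exists_eq {L : DAlg X k} (hL : IsRightIntegral C k L)
    (hε : counit k L = 1) :
    ∃ c : k, c * Fintype.card X = 1 ∧ L = c • ∑ x : X, e k (1, x) := by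
  -- The integral property is tested on δ_e ⊗ z, whose counit is 1. It gives both the support in δ_e
  -- and the translation invariance.
  have h : ∀ z, ∑ x, L (1, x) • e k (1, x * z) = L := fun z => by
    rw [← mul_e_one (C := C), hL.2, counit_e, if_pos rfl, one_smul]
  have hc : ∀ z, L (1, z) = L (1, 1) := fun z => by
    have := DFunLike.congr_fun (h z) (1, z)
    rw [← this]
    simp [e, Finsupp.single_apply, Finsupp.finsetSum_apply]
  have h1 : L = L (1, 1) • ∑ x : X, e k (1, x) := by
    conv_lhs => rw [← h 1]
    simp only [hc, mul_one, Finset.smul_sum]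
  refine ⟨L (1, 1), ?_, h1⟩
  -- The counit of the sum is |X|, so the normalisation makes |X| invertible in k.
  rw [h1] at hε
  simpa [counit_e] using hε

end DAlg

/-! ### Commutators as degrees -/

namespace CosetData

variable {X : Type*} [Group X] [Fintype X] [DecidableEq X] (C : CosetData X)

/-- The degree `b = y⁻¹ r⁻¹ y r` of `δ_{|b| y |b|⁻¹} ⊗ |b| r`. -/
def comm (_ : CosetData X) (y r : X) : X := y⁻¹ * r⁻¹ * y * r

/-- The pair `(|b| y |b|⁻¹, |b| r)` with `b = y⁻¹ r⁻¹ y r`. -/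
noncomputable def untwist (y r : X) : X × X :=
  (C.abs (C.comm y r) * y * (C.abs (C.comm y r))⁻¹, C.abs (C.comm y r) * r)

theorem deg_untwist (y r : X) : C.deg (C.untwist y r) = C.comm y r := by
  refine C.deg_eq ?_
  rw [C.circ_eq, C.rep_eq]
  simp only [untwist, conj]
  -- The value of |b| plays no role: once it is abstracted, an identity valid in every group
  -- remains.
  generalize C.abs (C.comm y r) = a
  simp only [comm]; group

/-- Every basis element of D arises by untwisting, so nothing is lost when D is described by the
twisted elements alone. -/
theorem untwist_conj (d : X × X) :
    C.untwist (C.conj d.1 (C.abs (C.deg d))) ((C.abs (C.deg d))⁻¹ * d.2) = d := by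
  have h : C.comm (C.conj d.1 (C.abs (C.deg d))) ((C.abs (C.deg d))⁻¹ * d.2) = C.deg d := by
    conv_rhs => rw [DAlg.deg_eq_word C d]
    simp only [comm, conj]; group
  rw [untwist, h]
  simp only [conj]
  ext <;> group

theorem comm_conj (y r z : X) : C.comm (C.conj y z) (C.conj r z) = C.conj (C.comm y r) z := by
  simp only [comm, conj]; group

theorem conj_left_inj (x y z : X) : C.conj y x = C.conj z x ↔ y = z := by
  simp [conj]

/-- `CosetData.conj` by a fixed element as a permutation. -/
def conjEquiv (x : X) : X ≃ X where
  toFun y := C.conj y x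
  invFun y := C.conj y x⁻¹
  left_inv y := by simp [conj, mul_assoc]
  right_inv y := by simp [conj, mul_assoc]

end CosetData

/-! ### The second object of 𝒟 carried by a representation -/

namespace RightRep

variable {X : Type*} [Group X] [Fintype X] [DecidableEq X] {C : CosetData X}
  {k : Type*} [Field k] {V : Type*} [AddCommGroup V] [Module k V]

/-- The action of the basis element `e d` of `D` on a right representation. -/
noncomputable def basisAct (R : RightRep C k V) (d : X × X) : V →ₗ[k] V :=
  R.ρ ∘ₗ (TensorProduct.mk k V (DAlg X k)).flip (DAlg.e k d)

theorem basisAct_apply (R : RightRep C k V) (d : X × X) (v : V) :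
    R.basisAct d v = R.ρ (v ⊗ₜ DAlg.e k d) := rfl

/-- This is associativity of ρ on basis elements: the associator applies τ to the vector, and the
product of D carries the compensating τ⁻¹. -/
theorem basisAct_basisAct (R : RightRep C k V) (d f : X × X) (v : V) :
    R.basisAct f (R.basisAct d v) = if f.1 = C.conj d.1 d.2 then
      R.basisAct (C.conj d.1 (C.tau (C.deg d) (C.deg f)),
        (C.tau (C.deg d) (C.deg f))⁻¹ * d.2 * f.2) (R.obj.act (C.tau (C.deg d) (C.deg f)) v)
      else 0 := by
  have h := LinearMap.congr_fun R.assoc ((v ⊗ₜ DAlg.e k d) ⊗ₜ DAlg.e k f)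
  simp only [LinearMap.comp_apply, LinearMap.rTensor_tmul] at h
  rw [DObj.associator_tmul _ _ _ v (DAlg.proj_deg C k d) (DAlg.proj_deg C k f),
    LinearMap.lTensor_tmul, DAlg.mul_e] at h
  simp only [basisAct_apply]
  rw [h]
  split_ifs <;> simp

theorem act_basisAct (R : RightRep C k V) (z : X) (d : X × X) (v : V) :
    R.obj.act z (R.basisAct d v) =
      R.basisAct (DAlg.actBasis C z d) (R.obj.act (C.lact (C.deg d) z) v) := by
  have h := R.isHom.2 z (v ⊗ₜ DAlg.e k d)
  change R.ρ (DObj.tensorAct _ _ z _) = _ at h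
  rw [DObj.tensorAct_tmul _ _ z v (DAlg.proj_deg C k d), DAlg.act_e] at h
  exact h.symm

theorem proj_basisAct (R : RightRep C k V) {g : X} {v : V} (hv : R.obj.proj g v = v) (d : X × X) :
    R.obj.proj (C.circ g (C.deg d)) (R.basisAct d v) = R.basisAct d v := by
  rw [basisAct_apply, ← R.isHom.1, DObj.tensor_proj_tmul _ _ hv (DAlg.proj_deg C k d)]

/-- The action of `δ_y ⊗ e`. -/
noncomputable def fiberProj (R : RightRep C k V) (y : X) : V →ₗ[k] V := R.basisAct (y, 1)

/-- The action of `X` on a right representation of `D` whose restriction to the `y`-component of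
the grading by the idempotents `δ_y ⊗ e` is
`ξ ↦ (ξ ◁^ |b|⁻¹) (δ_{|b| y |b|⁻¹} ⊗ |b| r)` with `b = y⁻¹ r⁻¹ y r`. -/
noncomputable def fiberAct (R : RightRep C k V) (r : X) : V →ₗ[k] V :=
  ∑ y, R.basisAct (C.untwist y r) ∘ₗ R.obj.act (C.abs (C.comm y r))⁻¹

/-- The element δ_w ⊗ e has degree e, so neither associator nor τ intervenes, and D behaves here
like an ordinary crossed product. -/
theorem fiberProj_basisAct (R : RightRep C k V) (w : X) (d : X × X) (v : V) :
    R.fiberProj w (R.basisAct d v) = if w = C.conj d.1 d.2 then R.basisAct d v else 0 := by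
  rw [fiberProj, basisAct_basisAct, DAlg.deg_eq_one_of_snd, DAlg.tau_one_right]
  simp [C.conj_one, R.obj.act_one]

theorem basisAct_fiberProj (R : RightRep C k V) (w : X) (d : X × X) (v : V) :
    R.basisAct d (R.fiberProj w v) = if d.1 = w then R.basisAct d v else 0 := by
  rw [fiberProj, basisAct_basisAct, DAlg.deg_eq_one_of_snd, DAlg.tau_one_left]
  simp only [C.conj_one, R.obj.act_one]
  split_ifs with h
  · simp [← h]
  · rfl

theorem fiberProj_fiberProj (R : RightRep C k V) (y z : X) (v : V) :
    R.fiberProj y (R.fiberProj z v) = if y = z then R.fiberProj z v else 0 := by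
  conv_lhs => rw [fiberProj.eq_1 R z]
  rw [fiberProj_basisAct]
  simp [C.conj_one, fiberProj]

theorem sum_fiberProj (R : RightRep C k V) (v : V) : ∑ y, R.fiberProj y v = v := by
  have := R.unit v
  rw [DAlg.one, TensorProduct.tmul_sum, map_sum] at this
  exact this

theorem act_fiberProj (R : RightRep C k V) (z y : X) (v : V) :
    R.obj.act z (R.fiberProj y v) = R.fiberProj (C.conj y z) (R.obj.act z v) := by
  have h : C.lact 1 z = z := by
    simp [CosetData.lact, CosetData.conj, DAlg.abs_one]
  rw [fiberProj, act_basisAct, DAlg.actBasis, DAlg.deg_eq_one_of_snd, h]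
  simp [fiberProj]

/-- The correction by |b|⁻¹ moves the idempotent at y exactly to the first index of the untwisted
element, so a single summand survives. -/
theorem fiberAct_fiberProj (R : RightRep C k V) (r y : X) (v : V) :
    R.fiberAct r (R.fiberProj y v) =
      R.basisAct (C.untwist y r) (R.obj.act (C.abs (C.comm y r))⁻¹ v) := by
  simp only [fiberAct, LinearMap.sum_apply, LinearMap.comp_apply, act_fiberProj,
    basisAct_fiberProj]
  have : ∀ z, (C.untwist z r).1 = C.conj y (C.abs (C.comm z r))⁻¹ ↔ z = y := fun z => by
    simp [CosetData.untwist, CosetData.conj]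
  simp [this]

theorem conj_untwist (C : CosetData X) (y r : X) :
    C.conj (C.untwist y r).1 (C.untwist y r).2 = C.conj y r := by
  simp only [CosetData.untwist]
  generalize C.abs (C.comm y r) = a
  simp only [CosetData.conj]; group

theorem fiberProj_fiberAct (R : RightRep C k V) (r y w : X) (v : V) :
    R.fiberProj w (R.fiberAct r (R.fiberProj y v)) =
      if w = C.conj y r then R.fiberAct r (R.fiberProj y v) else 0 := by
  rw [fiberAct_fiberProj, fiberProj_basisAct, conj_untwist]

/-- Two linear maps agree if they agree on the components of the grading by the idempotents
`δ_y ⊗ e`. -/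
theorem fiber_ext (R : RightRep C k V) {U : Type*} [AddCommGroup U] [Module k U]
    {f g : V →ₗ[k] U} (h : ∀ y v, f (R.fiberProj y v) = g (R.fiberProj y v)) (v : V) :
    f v = g v := by
  rw [← R.sum_fiberProj v, map_sum, map_sum]
  exact Finset.sum_congr rfl fun y _ => h y v

/-- The diagonal action of `X` intertwines `fiberAct r` and `fiberAct (z⁻¹ r z)`. -/
theorem act_fiberAct (R : RightRep C k V) (z r : X) (v : V) :
    R.obj.act z (R.fiberAct r v) = R.fiberAct (C.conj r z) (R.obj.act z v) := by
  refine R.fiber_ext (f := R.obj.act z ∘ₗ R.fiberAct r)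
    (g := R.fiberAct (C.conj r z) ∘ₗ R.obj.act z) (fun y v => ?_) v
  simp only [LinearMap.comp_apply]
  rw [act_fiberProj, fiberAct_fiberProj, fiberAct_fiberProj, act_basisAct, C.deg_untwist,
    ← R.obj.act_mul, ← R.obj.act_mul]
  congr 2
  · simp only [DAlg.actBasis, C.deg_untwist, CosetData.lact]
    rw [← C.comm_conj]
    simp only [CosetData.untwist]
    generalize C.abs (C.comm y r) = a
    generalize C.abs (C.comm (C.conj y z) (C.conj r z)) = b
    ext <;> simp only [CosetData.conj] <;> group
  · rw [C.comm_conj, CosetData.lact]; group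

theorem fiberAct_one (R : RightRep C k V) (v : V) : R.fiberAct 1 v = v := by
  conv_rhs => rw [← R.sum_fiberProj v]
  simp [fiberAct, fiberProj, CosetData.untwist, CosetData.comm, DAlg.abs_one, R.obj.act_one]

/-- The point is the cocycle identity [y, rs] = [y, r] [r⁻¹yr, s] for [y, r] = y⁻¹r⁻¹yr. It makes
the degrees multiply, so that the τ of the associator cancels against the three corrections by |b|.
-/
theorem fiberAct_mul (R : RightRep C k V) (r s : X) (v : V) :
    R.fiberAct (r * s) v = R.fiberAct s (R.fiberAct r v) := by
  refine R.fiber_ext (f := R.fiberAct (r * s))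
    (g := R.fiberAct s ∘ₗ R.fiberAct r) (fun y v => ?_) v
  simp only [LinearMap.comp_apply]
  -- The image already lies in the component of r⁻¹yr. Making this projection explicit lets the
  -- outer action be expanded on one component.
  have hproj := R.fiberProj_fiberAct r y (C.conj y r) v
  rw [if_pos rfl] at hproj
  rw [← hproj]
  rw [fiberAct_fiberProj, fiberAct_fiberProj, fiberAct_fiberProj, act_basisAct,
    basisAct_basisAct, C.deg_untwist, DAlg.deg_actBasis, C.deg_untwist, C.tau_eq]
  set b₁ := C.comm y r with hb₁
  set b₂ := C.comm (C.conj y r) s with hb₂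
  have hb : C.circ (C.conj b₁ (C.abs b₂)⁻¹) b₂ = C.comm y (r * s) := by
    rw [C.circ_eq, C.rep_eq]
    generalize C.abs b₂ = a
    rw [hb₁, hb₂]
    simp only [CosetData.conj, CosetData.comm]; group
  rw [hb, if_pos]
  · rw [← R.obj.act_mul, ← R.obj.act_mul]
    congr 2
    · simp only [DAlg.actBasis, C.deg_untwist, CosetData.lact]
      simp only [CosetData.untwist, ← hb₁, ← hb₂]
      generalize C.abs (C.conj b₁ (C.abs b₂)⁻¹) = β
      generalize C.abs b₁ = a₁
      generalize C.abs b₂ = a₂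
      generalize C.abs (C.comm y (r * s)) = a₃
      ext <;> simp only [CosetData.conj] <;> group
    · simp only [CosetData.lact]; group
  · simp only [DAlg.actBasis, C.deg_untwist, CosetData.lact]
    simp only [CosetData.untwist, ← hb₁, ← hb₂]
    generalize C.abs (C.conj b₁ (C.abs b₂)⁻¹) = β
    generalize C.abs b₁ = a₁
    generalize C.abs b₂ = a₂
    simp only [CosetData.conj]; group

/-- The second structure of an object of `𝒟` on a right representation of `D`, given by the
idempotents `δ_y ⊗ e` and by `fiberAct`.  It determines the action of `D`, see
`RightRep.basisAct_eq`. -/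
noncomputable def fiber (R : RightRep C k V) : DObj C k V where
  proj := R.fiberProj
  act := R.fiberAct
  proj_proj := R.fiberProj_fiberProj
  sum_proj := R.sum_fiberProj
  act_one := R.fiberAct_one
  act_mul := R.fiberAct_mul
  act_proj x y v := by
    conv_rhs => rw [← R.sum_fiberProj v]
    simp only [map_sum, fiberProj_fiberAct, C.conj_left_inj]
    simp

/-- Inverting the formula for the second action recovers D from the two structures. A map compatible
with both therefore commutes with D. -/
theorem basisAct_eq (R : RightRep C k V) (d : X × X) (v : V) :
    R.basisAct d v = R.fiber.act ((C.abs (C.deg d))⁻¹ * d.2)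
      (R.fiber.proj (C.conj d.1 (C.abs (C.deg d))) (R.obj.act (C.abs (C.deg d)) v)) := by
  change _ = R.fiberAct _ (R.fiberProj _ _)
  rw [fiberAct_fiberProj]
  conv_rhs => rw [← C.deg_untwist, C.untwist_conj, ← R.obj.act_mul, mul_inv_cancel, R.obj.act_one]

/-- The second action does not preserve the first grading: on the component y it multiplies degrees
on the right by a commutator. -/
theorem proj_fiberAct (R : RightRep C k V) {g : X} {v : V} (hv : R.obj.proj g v = v) (r y : X) :
    R.obj.proj (g * C.comm y r) (R.fiberAct r (R.fiberProj y v)) =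
      R.fiberAct r (R.fiberProj y v) := by
  rw [fiberAct_fiberProj]
  have := R.proj_basisAct (R.obj.act_of_mem hv (C.abs (C.comm y r))⁻¹) (C.untwist y r)
  have h : C.circ (C.conj g (C.abs (C.comm y r))⁻¹) (C.comm y r) = g * C.comm y r := by
    rw [C.circ_eq, C.rep_eq, CosetData.conj]; group
  rwa [C.deg_untwist, h] at this

end RightRep

/-! ### Coproduct and antipode on the support of the integral -/

namespace DAlg

variable {X : Type*} [Group X] [Fintype X] [DecidableEq X] (C : CosetData X)

theorem shift_one (x b : X) : shift C (1, x) b = C.abs (degSnd C (1, x) b) := by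
  rw [shift, deg_of_fst_eq_one C rfl, abs_one]; group

theorem degSnd_one (x b : X) : degSnd C (1, x) b = b⁻¹ * x⁻¹ * b * x := by
  rw [degSnd, deg_of_fst_eq_one C rfl, abs_one]; group

theorem comulSnd_eq_untwist (x b : X) : comulSnd C (1, x) b = C.untwist b x := by
  rw [comulSnd, shift_one, CosetData.untwist, degSnd_one]; rfl

theorem degFst_one (x b : X) :
    degFst C (1, x) b = C.conj (degSnd C (1, x) b)⁻¹ (C.abs (degSnd C (1, x) b))⁻¹ := by
  rw [degFst, deg_of_fst_eq_one C rfl, C.rep_eq, CosetData.conj]; group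

/-- The antipode turns the first leg into an inverse of the second, up to a τ that the later Φ⁻¹
removes. -/
theorem antipodeBasis_comulFst (x b : X) :
    antipodeBasis C (comulFst C (1, x) b) =
      (C.conj b (x * (C.tau (degFst C (1, x) b) (degSnd C (1, x) b))⁻¹),
        C.tau (degFst C (1, x) b) (degSnd C (1, x) b) * x⁻¹ *
          (C.abs (degSnd C (1, x) b))⁻¹) := by
  rw [tau_degFst_degSnd, antipodeBasis, deg_comulFst, C.rep_eq (degFst C (1, x) b)]
  simp only [comulFst, comulSnd, shift_one]
  generalize C.abs (degFst C (1, x) b) = w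
  rw [degFst_one]
  generalize C.abs (degSnd C (1, x) b) = a
  simp only [degSnd_one, CosetData.conj]
  ext <;> group

/-- The degree of the second leg is v, so |v| can be read off from the leg and its twist undone. -/
theorem comulSnd_injective :
    Function.Injective fun q : X × X => comulSnd C (1, q.2) q.1 := by
  rintro ⟨b, x⟩ ⟨b', x'⟩ h
  simp only at h
  have hdeg := congrArg C.deg h
  rw [deg_comulSnd, deg_comulSnd] at hdeg
  simp only [comulSnd, shift_one, hdeg, Prod.mk.injEq, mul_left_inj, mul_right_inj] at h
  simp [h]

end DAlg

/-! ### The averaged map as a group average -/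

namespace RightRep

variable {X : Type*} [Group X] [Fintype X] [DecidableEq X] {C : CosetData X}
  {k : Type*} [Field k] {V : Type*} [AddCommGroup V] [Module k V]

open DAlg in
theorem average_apply (R : RightRep C k V) (c : k) (p : V →ₗ[k] V) (v : V) :
    R.average R (c • ∑ x : X, e k (1, x)) p v = c • ∑ q : X × X,
      R.basisAct (comulSnd C (1, q.2) q.1)
        (p (R.basisAct (antipodeBasis C (comulFst C (1, q.2) q.1))
          (R.obj.act (C.tau (degFst C (1, q.2) q.1) (degSnd C (1, q.2) q.1))⁻¹ v))) := by
  change R.ρ (p.rTensor _ (R.ρ.rTensor _ (R.obj.associatorInv (DAlg.obj C k) (DAlg.obj C k)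
    (((antipode C k).rTensor _).lTensor V ((comul C k).lTensor V (v ⊗ₜ _)))))) = _
  simp only [TensorProduct.tmul_smul, map_smul, TensorProduct.tmul_sum, map_sum, LinearMap.lTensor_tmul,
    comul_e, LinearMap.rTensor_tmul, antipode_e]
  rw [Fintype.sum_prod_type_right]
  congr 1
  refine Finset.sum_congr rfl fun x _ => Finset.sum_congr rfl fun b _ => ?_
  have h1 := proj_deg C k (antipodeBasis C (comulFst C (1, x) b))
  have h2 := proj_deg C k (comulSnd C (1, x) b)
  rw [deg_antipodeBasis, deg_comulFst] at h1
  rw [deg_comulSnd] at h2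
  rw [DObj.associatorInv_tmul _ _ _ v h1 h2]
  rfl

open DAlg in
-- With a = |v|, the legs act as ax and (ax)⁻¹ around the projection of degree aba⁻¹. The pairs
-- (aba⁻¹, ax) run once through X × X.
theorem average_eq_of_isCanonical {R : RightRep C k V} (hR : R.IsCanonical) (c : k)
    (p : V →ₗ[k] V) :
    R.average R (c • ∑ x : X, e k (1, x)) p = R.obj.homAverage c p := by
  have hT : ∀ d v, R.basisAct d v = R.obj.act d.2 (R.obj.proj d.1 v) := fun d v => by
    rw [basisAct_apply, hR, canonicalAct_tmul]
  ext v
  rw [average_apply, DObj.homAverage_apply]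
  congr 1
  refine Fintype.sum_bijective _ (Finite.injective_iff_bijective.mp (comulSnd_injective C)) _ _ ?_
  rintro ⟨b, x⟩
  simp only [hT]
  congr 3
  rw [antipodeBasis_comulFst, R.obj.act_proj, ← R.obj.act_mul]
  generalize C.tau _ _ = t
  simp only [comulSnd, shift_one]
  generalize C.abs _ = a
  congr 2
  · simp only [CosetData.conj]; group
  · simp only [mul_inv_rev]; group

open DAlg in
-- The second leg is the second action of x preceded by |v|, where v = [b, x]. Since p commutes with
-- the given action, |v| passes through p and turns the first leg into the second action of x⁻¹. The
-- summands then agree without reindexing.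
theorem average_eq_of_isHom {R : RightRep C k V} (c : k) {p : V →ₗ[k] V}
    (hp : R.obj.IsHom R.obj p) :
    R.average R (c • ∑ x : X, e k (1, x)) p = R.fiber.homAverage c p := by
  ext v
  rw [average_apply, DObj.homAverage_apply]
  congr 1
  refine Finset.sum_congr rfl fun q _ => ?_
  obtain ⟨b, x⟩ := q
  have hd : degSnd C (1, x) b = C.comm b x := degSnd_one C x b
  have hi : C.comm (C.conj b x) x⁻¹ = (C.comm b x)⁻¹ := by
    simp only [CosetData.comm, CosetData.conj]; group
  have key : ∀ u, R.basisAct (C.untwist b x) u =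
      R.fiberAct x (R.fiberProj b (R.obj.act (C.abs (C.comm b x)) u)) := fun u => by
    rw [fiberAct_fiberProj, ← R.obj.act_mul, mul_inv_cancel, R.obj.act_one]
  change _ = R.fiberAct x (R.fiberProj b (p (R.fiberProj b (R.fiberAct x⁻¹ v))))
  have hE : R.fiberProj b (R.fiberAct x⁻¹ v) =
      R.fiberAct x⁻¹ (R.fiberProj (C.conj b x) v) := by
    have := R.fiber.act_proj x⁻¹ (C.conj b x) v
    rw [← C.conj_mul, mul_inv_cancel, C.conj_one] at this
    exact this.symm
  have hdeg : C.deg (antipodeBasis C (comulFst C (1, x) b)) = degFst C (1, x) b := by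
    rw [deg_antipodeBasis, deg_comulFst]
  rw [hE, fiberAct_fiberProj R x⁻¹, hi, comulSnd_eq_untwist, key, ← hp.2, act_basisAct,
    hdeg, ← R.obj.act_mul]
  -- The first leg has degree w = |v| v⁻¹ |v|⁻¹, and conjugating by |v| leaves v⁻¹. The factor τ
  -- cancels against Φ⁻¹, while |v⁻¹|⁻¹ is the correction built into the second action of x⁻¹.
  have hl : C.lact (degFst C (1, x) b) (C.abs (C.comm b x)) =
      C.tau (degFst C (1, x) b) (degSnd C (1, x) b) * (C.abs (C.comm b x)⁻¹)⁻¹ := by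
    have h : C.conj (degFst C (1, x) b) (C.abs (C.comm b x)) = (C.comm b x)⁻¹ := by
      rw [degFst_one, ← C.conj_mul, hd, inv_mul_cancel, C.conj_one]
    rw [CosetData.lact, h, tau_degFst_degSnd, shift_one, hd]
  congr 4
  · rw [actBasis, hdeg, hl, antipodeBasis_comulFst, CosetData.untwist, hi, hd]
    generalize C.tau _ _ = t
    generalize C.abs (C.comm b x)⁻¹ = a'
    generalize C.abs (C.comm b x) = a
    simp only [CosetData.conj]
    ext
    all_goals group
  · rw [hl]; group

/-- If `p` is a morphism of `𝒟`, so is its average over the second structure. -/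
theorem isHom_homAverage_fiber {R : RightRep C k V} (c : k) {p : V →ₗ[k] V}
    (hp : R.obj.IsHom R.obj p) : R.obj.IsHom R.obj (R.fiber.homAverage c p) := by
  have hF : ∀ v, R.fiber.homAverage c p v = c • ∑ q : X × X,
      R.fiberAct q.2 (R.fiberProj q.1 (p (R.fiberProj q.1 (R.fiberAct q.2⁻¹ v)))) :=
    R.fiber.homAverage_apply c p
  constructor
  · refine R.obj.map_proj_of_forall_mem fun g v hv => ?_
    -- On one component of the second grading, the second action shifts the degree by a single
    -- commutator.
    suffices h : ∀ y, R.obj.proj g (R.fiber.homAverage c p (R.fiberProj y v)) =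
        R.fiber.homAverage c p (R.fiberProj y v) by
      rw [← R.sum_fiberProj v]
      simp only [map_sum, h]
    intro y
    rw [hF, map_smul, map_sum]
    congr 1
    refine Finset.sum_congr rfl fun q _ => ?_
    obtain ⟨b, x⟩ := q
    rw [fiberProj_fiberAct]
    split_ifs with hb
    · replace hb : b = C.conj y x⁻¹ := hb
      have h1 := R.proj_fiberAct hv x⁻¹ y
      have h2 := R.proj_fiberAct (v := p (R.fiberAct x⁻¹ (R.fiberProj y v)))
        (by rw [← hp.1, h1]) x b
      -- The shifts caused by x⁻¹ and then by x cancel, because p preserves the degree in between.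
      have hg : g * C.comm y x⁻¹ * C.comm b x = g := by
        rw [hb]; simp only [CosetData.comm, CosetData.conj]; group
      rwa [hg] at h2
    · simp
  · intro z v
    simp only [hF, map_smul, map_sum]
    congr 1
    symm
    -- The given action of z conjugates both the idempotents and the second action, so it only
    -- permutes the summands.
    refine Fintype.sum_equiv ((C.conjEquiv z).prodCongr (C.conjEquiv z)) _ _ fun q => ?_
    have : (C.conj q.2 z)⁻¹ = C.conj q.2⁻¹ z := by simp [CosetData.conj, mul_assoc]
    simp only [Equiv.prodCongr_apply, Prod.map, CosetData.conjEquiv, Equiv.coe_fn_mk, this,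
      act_fiberAct, act_fiberProj, ← hp.2]

/-- A linear map which is a morphism for both structures commutes with the action of `D`. -/
theorem isRepHom_of_isHom {R : RightRep C k V} {f : V →ₗ[k] V} (h : R.obj.IsHom R.obj f)
    (h' : R.fiber.IsHom R.fiber f) : R.IsRepHom R f := by
  refine ⟨h, fun v d => ?_⟩
  rw [DAlg.eq_sum_e d]
  simp only [TensorProduct.tmul_sum, TensorProduct.tmul_smul, map_sum, map_smul,
    ← basisAct_apply, basisAct_eq, h'.1, h'.2, h.2]

theorem isRepHom_of_isCanonical {R : RightRep C k V} (hR : R.IsCanonical) {f : V →ₗ[k] V}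
    (h : R.obj.IsHom R.obj f) : R.IsRepHom R f := by
  refine ⟨h, fun v d => ?_⟩
  rw [DAlg.eq_sum_e d, hR]
  simp only [TensorProduct.tmul_sum, TensorProduct.tmul_smul, map_sum, map_smul,
    DAlg.canonicalAct_tmul, h.1, h.2]

theorem isSubrep_ker {R : RightRep C k V} {f : V →ₗ[k] V} (h : R.IsRepHom R f) :
    R.IsSubrep (LinearMap.ker f) where
  proj_mem y v hv := by
    rw [LinearMap.mem_ker] at hv ⊢
    rw [h.1.1, hv, map_zero]
  act_mem x v hv := by
    rw [LinearMap.mem_ker] at hv ⊢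
    rw [h.1.2, hv, map_zero]
  ρ_mem d v hv := by
    rw [LinearMap.mem_ker] at hv ⊢
    rw [h.2, hv, TensorProduct.zero_tmul, map_zero]

/-- A subrepresentation is a subobject for both structures, since the second is built from ρ and the
given action. -/
theorem average_isProj_and_isRepHom (R : RightRep C k V) {c : k}
    (hc : c * Fintype.card X = 1) {W : Submodule k V} (hW : R.IsSubrep W) {p : V →ₗ[k] V}
    (hp : LinearMap.IsProj W p) (h : R.IsCanonical ∨ R.obj.IsHom R.obj p) :
    LinearMap.IsProj W (R.average R (c • ∑ x : X, DAlg.e k (1, x)) p) ∧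
      R.IsRepHom R (R.average R (c • ∑ x : X, DAlg.e k (1, x)) p) := by
  rcases h with h | h
  · rw [average_eq_of_isCanonical h]
    exact ⟨R.obj.homAverage_isProj hc hp hW.proj_mem hW.act_mem,
      isRepHom_of_isCanonical h (R.obj.homAverage_isHom c p)⟩
  · rw [average_eq_of_isHom c h]
    refine ⟨R.fiber.homAverage_isProj hc hp (fun y v hv => hW.ρ_mem _ v hv) fun x v hv => ?_,
      isRepHom_of_isHom (isHom_homAverage_fiber c h) (R.fiber.homAverage_isHom c p)⟩
    change R.fiberAct x v ∈ W
    rw [fiberAct, LinearMap.sum_apply]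
    exact W.sum_mem fun y _ => hW.ρ_mem _ _ (hW.act_mem _ _ hv)

end RightRep

theorem mainTheorem1 {X : Type*} [Group X] [Fintype X] [DecidableEq X] (C : CosetData X)
    {k : Type*} [Field k] (L : DAlg X k) (hL : DAlg.IsRightIntegral C k L)
    (hε : DAlg.counit k L = 1)
    {V : Type*} [AddCommGroup V] [Module k V] (R : RightRep C k V)
    (W : Submodule k V) (hW : R.IsSubrep W) :
    (∃ W₀ : Submodule k V, R.IsSubrep W₀ ∧ IsCompl W W₀) ∧
    (∃ p : V →ₗ[k] V, LinearMap.IsProj W p ∧ R.obj.IsHom R.obj p) ∧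
    (∀ p : V →ₗ[k] V, LinearMap.IsProj W p → (R.IsCanonical ∨ R.obj.IsHom R.obj p) →
      LinearMap.IsProj W (R.average R L p) ∧ R.IsRepHom R (R.average R L p) ∧
      R.IsSubrep (LinearMap.ker (R.average R L p)) ∧
      IsCompl W (LinearMap.ker (R.average R L p))) := by
  obtain ⟨c, hc, rfl⟩ := hL.exists_eq hε
  -- Any linear complement will do as a start: averaging over the given structure produces a
  -- morphism of 𝒟.
  obtain ⟨W', hW'⟩ := W.exists_isCompl
  have h₀ : LinearMap.IsProj W (W.projection W' hW') :=
    ⟨fun v => Submodule.projection_apply_mem hW' v,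
      fun v hv => Submodule.projection_apply_left hW' ⟨v, hv⟩⟩
  have hp := R.obj.homAverage_isProj hc h₀ hW.proj_mem hW.act_mem
  have hhom := R.obj.homAverage_isHom c (W.projection W' hW')
  -- The second averaging, by Λ, adds compatibility with D, and its kernel is the required
  -- complement.
  obtain ⟨hproj, hrep⟩ := R.average_isProj_and_isRepHom hc hW hp (Or.inr hhom)
  refine ⟨⟨_, RightRep.isSubrep_ker hrep, hproj.isCompl⟩, ⟨_, hp, hhom⟩, fun p hp h => ?_⟩
  obtain ⟨hproj, hrep⟩ := R.average_isProj_and_isRepHom hc hW hp h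
  exact ⟨hproj, hrep, RightRep.isSubrep_ker hrep, hproj.isCompl⟩
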